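/- For a prime number $p$ let $R=\{x^2 : x\in\mathbb{F}_p^*\}\subseteq\mathbb{F}_p$ be the set of non-zero quadratic residues modulo $p$, and let $d(p)$ be the length of the longest run of consecutive quadratic residues modulo $p$, that is, the largest integer $n\ge 0$ such that $\{a,a+1,\dots,a+n-1\}\subseteq R$ for some $a\in\mathbb{F}_p$. Then $d(p)\ll p^{1/4}\log p$; that is, there is an absolute constant $C>0$ such that for every prime $p$ $$d(p)\le C\,p^{1/4}\log_2 p .$$ -/

import Mathlib

/-- The set `R = {x² : x ∈ 𝔽_p^*}` of (nonzero) quadratic residues modulo `p`. -/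
def quadResidues (p : ℕ) : Set (ZMod p) :=
  {y | ∃ x : ZMod p, x ≠ 0 ∧ y = x ^ 2}

/-- The lengths `n` for which some block `a, a + 1, …, a + (n - 1)` of residue classes modulo `p`
consists of quadratic residues only. -/
def residueRunLengths (p : ℕ) : Set ℕ :=
  {n | ∃ a : ZMod p, ∀ i : ℕ, i < n → a + (i : ZMod p) ∈ quadResidues p}

/-- The length `d(p)` of the longest run of consecutive quadratic residues modulo `p`. -/
noncomputable def longestResidueRun (p : ℕ) : ℕ :=
  sSup (residueRunLengths p)

/-- For prime `p` the supremum defining `d(p)` is a maximum. -/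
theorem longestResidueRun_isGreatest (p : ℕ) (hp : p.Prime) :
    IsGreatest (residueRunLengths p) (longestResidueRun p) := by
  haveI : Fact p.Prime := ⟨hp⟩
  have hne : (residueRunLengths p).Nonempty := ⟨0, 0, fun i hi => absurd hi (Nat.not_lt_zero i)⟩
  have hbdd : BddAbove (residueRunLengths p) := by
    refine ⟨p, ?_⟩
    rintro n ⟨a, ha⟩
    by_contra! hlt
    obtain ⟨x, hx, hx2⟩ := ha (-a).val ((ZMod.val_lt (-a)).trans hlt)
    rw [ZMod.natCast_zmod_val, add_neg_cancel] at hx2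
    exact pow_ne_zero 2 hx hx2.symm
  exact ⟨Nat.sSup_mem hne hbdd, fun n hn => le_csSup hbdd hn⟩

/-!
Stepanov's method gives Weil's bound `O(m √p)` for the sum of the quadratic character over the
values of a polynomial of degree `m` that is not a constant times a square: an auxiliary polynomial
of small degree vanishes to high order wherever the character takes the value `1`, so it cannot do
so too often, and twisting by a nonresidue gives the lower bound. Hence, for `h ≈ log₂ p`, only
`O(h √p)` blocks of length `h` have constant character.

Suppose now that `a, a + 1, …` is a run of residues of length `L + h Q`. For `i < L` and
`1 ≤ q ≤ Q`, the block of length `h` starting at `(a + i) / q` has constant character `χ(q)`,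
because `q` maps it into the run. By Dirichlet's theorem `a = u / w` modulo `p` with `w ≪ Q` and
`u ≪ p / Q`, so as long as `L Q² ≪ p` two such starting points agree modulo `p` only if the
rational numbers `(u + i w) / q` agree. A positive proportion of these fractions is in lowest terms,
which yields `≫ L Q` different blocks. Hence `L Q ≪ h √p`, and `Q ≈ p ^ (1 / 4)` gives the theorem.
-/

open Polynomial

section Stepanov

variable {R : Type*} [CommSemiring R]

/-- The operator `u ↦ v` determined by `(f ^ a * u)⁽ˡ⁾ = f ^ (a - l) * v`, which isolates the part
of a derivative of `f ^ a * u` whose degree does not grow with `a`. It is given by the recursion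
for the exponent of `f`, which makes sense for every `l`, but means this only for `l ≤ a`. -/
noncomputable def derivCofactor (f : R[X]) (a : ℕ) : ℕ → R[X] →ₗ[R] R[X]
  | 0 => LinearMap.id
  | l + 1 =>
    LinearMap.mulLeft R (((a - l : ℕ) : R[X]) * derivative f) ∘ₗ derivCofactor f a l +
      LinearMap.mulLeft R f ∘ₗ derivative ∘ₗ derivCofactor f a l

theorem derivCofactor_succ (f u : R[X]) (a l : ℕ) :
    derivCofactor f a (l + 1) u =
      ((a - l : ℕ) : R[X]) * derivative f * derivCofactor f a l u +
        f * derivative (derivCofactor f a l u) :=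
  rfl

theorem iterate_derivative_pow_mul (f u : R[X]) {a l : ℕ} (hl : l ≤ a) :
    derivative^[l] (f ^ a * u) = f ^ (a - l) * derivCofactor f a l u := by
  induction l with
  | zero => simp [derivCofactor]
  | succ l ih =>
    obtain ⟨b, rfl⟩ := Nat.exists_eq_add_of_le' hl
    rw [Function.iterate_succ_apply', ih (by omega), derivCofactor_succ, Nat.add_sub_cancel,
      show b + (l + 1) - l = b + 1 by omega, derivative_mul, derivative_pow, Nat.add_sub_cancel,
      map_natCast]
    ring

theorem natDegree_derivCofactor_le (f u : R[X]) (a l : ℕ) :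
    (derivCofactor f a l u).natDegree ≤ u.natDegree + l * f.natDegree := by
  induction l with
  | zero => simp [derivCofactor]
  | succ l ih =>
    rw [derivCofactor_succ, add_mul, one_mul, ← add_assoc, add_comm _ f.natDegree]
    refine natDegree_add_le_of_degree_le
      (natDegree_mul_le_of_le (natDegree_mul_le_of_le (m := 0) ?_ ?_ |>.trans (zero_add _).le) ih)
      (natDegree_mul_le_of_le le_rfl ?_)
    · exact (natDegree_natCast _).le
    · exact (natDegree_derivative_le f).trans (Nat.sub_le _ _)
    · exact (natDegree_derivative_le _).trans ((Nat.sub_le _ _).trans ih)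

theorem iterate_derivative_mul_X_pow_char (p : ℕ) [CharP R p] (u : R[X]) (j l : ℕ) :
    derivative^[l] (u * X ^ (p * j)) = derivative^[l] u * X ^ (p * j) := by
  induction l with
  | zero => rfl
  | succ l ih =>
    rw [Function.iterate_succ_apply', ih, Function.iterate_succ_apply', derivative_mul,
      derivative_X_pow]
    simp

/-- Stepanov's auxiliary polynomial. At a root of `f ^ b - 1` in `ZMod q`, its derivatives of order
less than `M` have a factor of small degree, as both `f ^ b` and `X ^ q` become trivial there. -/
noncomputable def stepanovPoly (f : R[X]) (M b q : ℕ) {J : ℕ} (k k' : Fin J → R[X]) : R[X] :=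
  ∑ j, (f ^ M * k j + f ^ (M + b) * k' j) * X ^ (q * (j : ℕ))

theorem stepanovPoly_eq_mul (f : R[X]) (M b q : ℕ) {J : ℕ} (k k' : Fin J → R[X]) :
    stepanovPoly f M b q k k' = f ^ M * ∑ j, (k j + f ^ b * k' j) * X ^ (q * (j : ℕ)) := by
  rw [stepanovPoly, Finset.mul_sum]
  exact Finset.sum_congr rfl fun j _ => by ring

theorem iterate_derivative_stepanovPoly {p : ℕ} [CharP R p] (f : R[X]) {M l : ℕ} (hl : l ≤ M)
    (b : ℕ) {J : ℕ} (k k' : Fin J → R[X]) :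
    derivative^[l] (stepanovPoly f M b p k k') =
      stepanovPoly f (M - l) b p (fun j => derivCofactor f M l (k j))
        (fun j => derivCofactor f (M + b) l (k' j)) := by
  simp only [stepanovPoly, iterate_derivative_sum, iterate_derivative_mul_X_pow_char,
    iterate_map_add]
  refine Finset.sum_congr rfl fun j _ => ?_
  rw [iterate_derivative_pow_mul f _ hl, iterate_derivative_pow_mul f _ (by omega),
    show M + b - l = M - l + b by omega]

theorem natDegree_stepanovPoly_le (f : R[X]) (M b q : ℕ) {J K : ℕ} {k k' : Fin J → R[X]}
    (hk : ∀ j, (k j).natDegree ≤ K) (hk' : ∀ j, (k' j).natDegree ≤ K) :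
    (stepanovPoly f M b q k k').natDegree ≤ (M + b) * f.natDegree + K + q * J := by
  refine natDegree_sum_le_of_forall_le _ _ fun j _ => natDegree_mul_le_of_le
    (natDegree_add_le_of_degree_le ?_ ?_) ((natDegree_X_pow_le _).trans ?_)
  · refine natDegree_mul_le_of_le (natDegree_pow_le.trans ?_) (hk j)
    gcongr
    omega
  · exact natDegree_mul_le_of_le natDegree_pow_le (hk' j)
  · exact Nat.mul_le_mul_left _ j.2.le

section Field

variable {F : Type*} [Field F]

theorem exists_ne_zero_forall_apply_eq_zero {V ι : Type*} [AddCommGroup V] [Module F V]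
    [Fintype ι] {D : ℕ} (Ψ : ι → V →ₗ[F] F[X]) (hdeg : ∀ i v, (Ψ i v).natDegree < D)
    (hdim : Fintype.card ι * D < Module.finrank F V) : ∃ v ≠ 0, ∀ i, Ψ i v = 0 := by
  have : FiniteDimensional F V := .of_finrank_pos (by omega)
  let Φ : V →ₗ[F] ι → Fin D → F :=
    LinearMap.pi fun i => LinearMap.pi fun n => lcoeff F n ∘ₗ Ψ i
  have hlt : Module.finrank F (ι → Fin D → F) < Module.finrank F V := by
    simpa [Module.finrank_pi_fintype] using hdim
  obtain ⟨v, hv, hv0⟩ := Submodule.exists_mem_ne_zero_of_ne_bot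
    (LinearMap.ker_ne_bot_of_finrank_lt (f := Φ) hlt)
  refine ⟨v, hv0, fun i => ext fun n => ?_⟩
  by_cases hn : n < D
  · simpa [Φ] using congrFun (congrFun (LinearMap.mem_ker.mp hv) i) ⟨n, hn⟩
  · rw [coeff_eq_zero_of_natDegree_lt ((hdeg i v).trans_le (not_lt.mp hn)), coeff_zero]

theorem natDegree_lt_of_mem_degreeLT {K : ℕ} (hK : 0 < K) {w : F[X]} (hw : w ∈ degreeLT F K) :
    w.natDegree < K := by
  rcases eq_or_ne w 0 with rfl | h
  · rwa [natDegree_zero]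
  · exact (natDegree_lt_iff_degree_lt h).mpr (mem_degreeLT.mp hw)

theorem exists_forall_sum_derivCofactor_eq_zero (f : F[X]) (b : ℕ) {J K M : ℕ}
    (hdim : M * (K + M * f.natDegree + J) < 2 * (J * K)) :
    ∃ k k' : Fin J → F[X], (∀ j, (k j).natDegree < K) ∧ (∀ j, (k' j).natDegree < K) ∧
      (∃ j, k j ≠ 0 ∨ k' j ≠ 0) ∧ ∀ l < M,
        ∑ j, (derivCofactor f M l (k j) + derivCofactor f (M + b) l (k' j)) * X ^ (j : ℕ) = 0 := by
  have hK : 0 < K := Nat.pos_of_ne_zero <| by rintro rfl; simp at hdim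
  let Ψ (l : Fin M) : (Fin J → degreeLT F K × degreeLT F K) →ₗ[F] F[X] :=
    ∑ j : Fin J, LinearMap.mulRight F (X ^ (j : ℕ)) ∘ₗ
      (derivCofactor f M l ∘ₗ (degreeLT F K).subtype).coprod
        (derivCofactor f (M + b) l ∘ₗ (degreeLT F K).subtype) ∘ₗ LinearMap.proj j
  have hΨ (l : Fin M) (v) : Ψ l v = ∑ j, (derivCofactor f M l (v j).1 +
      derivCofactor f (M + b) l (v j).2) * X ^ (j : ℕ) := by
    simp [Ψ]
  have hdegΨ (l : Fin M) (v) : (Ψ l v).natDegree < K + M * f.natDegree + J := by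
    rw [hΨ]
    have hcofactor (a : ℕ) (w : degreeLT F K) :
        (derivCofactor f a l w).natDegree ≤ K - 1 + M * f.natDegree :=
      (natDegree_derivCofactor_le f w a l).trans <|
        add_le_add (Nat.le_sub_one_of_lt (natDegree_lt_of_mem_degreeLT hK w.2))
          (Nat.mul_le_mul_right _ l.2.le)
    refine (natDegree_sum_le_of_forall_le (n := K - 1 + M * f.natDegree + J) _ _ fun j _ =>
      natDegree_mul_le_of_le (natDegree_add_le_of_degree_le (hcofactor _ _) (hcofactor _ _))
        ((natDegree_X_pow_le _).trans j.2.le)).trans_lt (by omega)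
  have hrank : Module.finrank F (Fin J → degreeLT F K × degreeLT F K) = 2 * (J * K) := by
    have : Module.Finite F (degreeLT F K) := .equiv (degreeLTEquiv F K).symm
    rw [Module.finrank_pi_fintype]
    simp only [Module.finrank_prod, (degreeLTEquiv F K).finrank_eq, Module.finrank_fin_fun,
      Finset.sum_const, Finset.card_univ, Fintype.card_fin, smul_eq_mul]
    ring
  obtain ⟨v, hv0, hv⟩ := exists_ne_zero_forall_apply_eq_zero Ψ hdegΨ (by simpa [hrank] using hdim)
  refine ⟨fun j => (v j).1, fun j => (v j).2, fun j => ?_, fun j => ?_, ?_, fun l hl => ?_⟩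
  · exact natDegree_lt_of_mem_degreeLT hK (v j).1.2
  · exact natDegree_lt_of_mem_degreeLT hK (v j).2.2
  · by_contra! hall
    exact hv0 <| funext fun j => Prod.ext (Subtype.ext (hall j).1) (Subtype.ext (hall j).2)
  · rw [← hΨ ⟨l, hl⟩, hv]

theorem eq_zero_of_sq_mul_eq_C_mul_sq {f k k' : F[X]} (hf : ∀ c g, f ≠ C c * g ^ 2) {c : F}
    (h : k ^ 2 * f = C c * k' ^ 2) : k = 0 := by
  by_contra hk
  have hc : c ≠ 0 := by
    rintro rfl
    exact hf 0 0 (by simpa [hk] using h)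
  have hdvd : k ^ 2 ∣ k' ^ 2 :=
    (isUnit_C.mpr hc.isUnit).dvd_mul_left.mp (Dvd.intro f h)
  obtain ⟨g, rfl⟩ := (IsIntegrallyClosed.pow_dvd_pow_iff two_ne_zero).mp hdvd
  refine hf c g (mul_left_cancel₀ (pow_ne_zero 2 hk) ?_)
  rw [h]
  ring

theorem mul_card_le_natDegree_of_le_rootMultiplicity {f : F[X]} {s : Finset F} {M : ℕ}
    (h : ∀ x ∈ s, M ≤ f.rootMultiplicity x) : M * s.card ≤ f.natDegree := by
  classical
  have hle : M • s.val ≤ f.roots := by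
    rw [Multiset.le_iff_count]
    intro x
    rw [Multiset.count_nsmul, count_roots]
    by_cases hx : x ∈ s
    · rw [Multiset.count_eq_one_of_mem s.nodup hx, mul_one]
      exact h x hx
    · rw [Multiset.count_eq_zero_of_notMem hx, mul_zero]
      exact Nat.zero_le _
  simpa using (Multiset.card_le_card hle).trans (card_roots' f)

end Field

section Prime

variable {p : ℕ} [Fact p.Prime] {f : (ZMod p)[X]}

theorem X_pow_dvd_pow_sub_C (f : (ZMod p)[X]) : X ^ p ∣ f ^ p - C (f.eval 0) := by
  have h : f ^ p - C (f.eval 0) = (f - C (f.eval 0)) ^ p := by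
    rw [sub_pow_char, ← C_pow, ZMod.pow_card]
  rw [h]
  refine pow_dvd_pow_of_dvd (X_dvd_iff.mpr ?_) p
  simp [coeff_zero_eq_eval_zero]

theorem eq_zero_of_X_pow_dvd_add_pow_mul (hp : p ≠ 2) {K : ℕ} {k k' : (ZMod p)[X]}
    (hf : ∀ c g, f ≠ C c * g ^ 2) (hf0 : f.eval 0 ≠ 0)
    (hk : k.natDegree < K) (hk' : k'.natDegree < K) (hK : 2 * K + f.natDegree ≤ p + 1)
    (h : X ^ p ∣ k + f ^ (p / 2) * k') : k = 0 ∧ k' = 0 := by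
  have hfp : f ^ p = f ^ (p / 2) * f ^ (p / 2) * f := by
    obtain ⟨n, hn⟩ := (Fact.out : p.Prime).odd_of_ne_two hp
    rw [← pow_add, ← pow_succ]
    congr 1
    omega
  -- Modulo `X ^ p` we have `f ^ p ≡ f(0)`, so squaring removes the power of `f`.
  have hdvd : X ^ p ∣ k ^ 2 * f - C (f.eval 0) * k' ^ 2 := by
    have hsplit : k ^ 2 * f - C (f.eval 0) * k' ^ 2 =
        (k + f ^ (p / 2) * k') * ((k - f ^ (p / 2) * k') * f) +
          (f ^ p - C (f.eval 0)) * k' ^ 2 := by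
      rw [hfp]; ring
    rw [hsplit]
    exact dvd_add (h.mul_right _) ((X_pow_dvd_pow_sub_C f).mul_right _)
  have hdeg : (k ^ 2 * f - C (f.eval 0) * k' ^ 2).natDegree < (X ^ p : (ZMod p)[X]).natDegree := by
    rw [natDegree_X_pow]
    have hpos : 0 < p := (Fact.out : p.Prime).pos
    refine (natDegree_sub_le_of_le (m := p - 1) (n := p - 1) ?_ ?_).trans_lt (by omega)
    · refine (natDegree_mul_le_of_le natDegree_pow_le le_rfl).trans ?_
      omega
    · exact (natDegree_C_mul_le _ _).trans (natDegree_pow_le.trans (by omega))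
  have heq : k ^ 2 * f - C (f.eval 0) * k' ^ 2 = 0 := eq_zero_of_dvd_of_natDegree_lt hdvd hdeg
  obtain rfl : k = 0 := eq_zero_of_sq_mul_eq_C_mul_sq hf (sub_eq_zero.mp heq)
  exact ⟨rfl, by simpa [hf0] using heq⟩

theorem eq_zero_of_stepanovPoly_eq_zero (hp : p ≠ 2) {M K J : ℕ} {k k' : Fin J → (ZMod p)[X]}
    (hf : ∀ c g, f ≠ C c * g ^ 2) (hf0 : f.eval 0 ≠ 0)
    (hk : ∀ j, (k j).natDegree < K) (hk' : ∀ j, (k' j).natDegree < K)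
    (hK : 2 * K + f.natDegree ≤ p + 1) (h : stepanovPoly f M (p / 2) p k k' = 0) (j : Fin J) :
    k j = 0 ∧ k' j = 0 := by
  have hfne : f ≠ 0 := by rintro rfl; simp at hf0
  have hsum : ∑ j, (k j + f ^ (p / 2) * k' j) * X ^ (p * (j : ℕ)) = 0 :=
    (mul_eq_zero.mp ((stepanovPoly_eq_mul ..).symm.trans h)).resolve_left (pow_ne_zero M hfne)
  induction j using WellFoundedLT.induction with
  | ind j ih =>
    refine eq_zero_of_X_pow_dvd_add_pow_mul hp hf hf0 (hk j) (hk' j) hK ?_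
    rw [← mul_dvd_mul_iff_right (pow_ne_zero (p * (j : ℕ)) (X_ne_zero (R := ZMod p))), ← pow_add]
    rw [← Finset.add_sum_erase _ _ (Finset.mem_univ j)] at hsum
    rw [eq_neg_of_add_eq_zero_left hsum, dvd_neg]
    refine Finset.dvd_sum fun i hi => ?_
    rcases lt_or_gt_of_ne (Finset.ne_of_mem_erase hi) with hij | hji
    · simp [ih i hij]
    · refine (pow_dvd_pow _ ?_).mul_left _
      calc p + p * (j : ℕ) = p * (j + 1) := by ring
        _ ≤ p * i := Nat.mul_le_mul_left _ hji

theorem isRoot_stepanovPoly {M b J : ℕ} {k k' : Fin J → (ZMod p)[X]} {x : ZMod p}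
    (hx : f.eval x ^ b = 1) (h : (∑ j, (k j + k' j) * X ^ (j : ℕ)).IsRoot x) :
    (stepanovPoly f M b p k k').IsRoot x := by
  rw [IsRoot, eval_finsetSum] at h
  rw [stepanovPoly_eq_mul, IsRoot, eval_mul, eval_finsetSum, ← mul_zero (eval x (f ^ M)), ← h]
  simp only [eval_mul, eval_add, eval_pow, eval_X, hx, one_mul, pow_mul, ZMod.pow_card]

theorem le_rootMultiplicity_of_isRoot_iterate_derivative {M : ℕ} (hM : M ≤ p) (hf : f ≠ 0)
    {x : ZMod p} (h : ∀ l < M, (derivative^[l] f).IsRoot x) : M ≤ f.rootMultiplicity x := by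
  rcases M with _ | M
  · exact Nat.zero_le _
  · refine lt_rootMultiplicity_of_isRoot_iterate_derivative_of_mem_nonZeroDivisors hf
      (fun l hl => h l (Nat.lt_succ_of_le hl)) ?_
    rw [mem_nonZeroDivisors_iff_ne_zero, Ne, CharP.cast_eq_zero_iff (ZMod p) p,
      (Fact.out : p.Prime).dvd_factorial]
    omega

theorem mul_card_filter_eval_pow_eq_one_le (hp : p ≠ 2) {K J M : ℕ}
    (hf : ∀ c g, f ≠ C c * g ^ 2) (hf0 : f.eval 0 ≠ 0)
    (hK : 2 * K + f.natDegree ≤ p + 1) (hM : M ≤ p)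
    (hdim : M * (K + M * f.natDegree + J) < 2 * (J * K)) :
    M * (Finset.univ.filter fun x : ZMod p => f.eval x ^ (p / 2) = 1).card ≤
      (M + p / 2) * f.natDegree + K + p * J := by
  obtain ⟨k, k', hk, hk', ⟨j, hj⟩, hrel⟩ := exists_forall_sum_derivCofactor_eq_zero f (p / 2) hdim
  have hne : stepanovPoly f M (p / 2) p k k' ≠ 0 := fun h => by
    have := eq_zero_of_stepanovPoly_eq_zero hp hf hf0 hk hk' hK h j
    tauto
  refine (mul_card_le_natDegree_of_le_rootMultiplicity fun x hx => ?_).trans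
    (natDegree_stepanovPoly_le f M (p / 2) p (fun j => (hk j).le) fun j => (hk' j).le)
  refine le_rootMultiplicity_of_isRoot_iterate_derivative hM hne fun l hl => ?_
  rw [iterate_derivative_stepanovPoly f hl.le]
  refine isRoot_stepanovPoly (Finset.mem_filter.mp hx).2 ?_
  rw [hrel l hl, IsRoot, eval_zero]

end Prime

end Stepanov

section Weil

theorem natDegree_pos_of_forall_ne_C_mul_sq {F : Type*} [Field F] {f : F[X]}
    (hf : ∀ c g, f ≠ C c * g ^ 2) : 0 < f.natDegree := by
  by_contra! h
  refine hf (f.coeff 0) 1 ?_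
  rw [one_pow, mul_one]
  exact eq_C_of_natDegree_le_zero h

theorem sum_quadraticChar_add_card {F ι : Type*} [Field F] [Fintype F] [DecidableEq F]
    [Fintype ι] (g : ι → F) :
    ∑ i, quadraticChar F (g i) + Fintype.card ι =
      2 * (Finset.univ.filter fun i => quadraticChar F (g i) = 1).card +
        (Finset.univ.filter fun i => g i = 0).card := by
  have hpt (i : ι) : quadraticChar F (g i) + 1 =
      2 * (if quadraticChar F (g i) = 1 then 1 else 0) + if g i = 0 then 1 else 0 := by
    rcases eq_or_ne (g i) 0 with h | h
    · simp [h]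
    · rcases quadraticChar_dichotomy h with h' | h' <;> simp [h, h']
  have hsum := Finset.sum_congr rfl fun i (_ : i ∈ Finset.univ) => hpt i
  rw [Finset.sum_add_distrib, Finset.sum_add_distrib, ← Finset.mul_sum, Finset.sum_boole,
    Finset.sum_boole] at hsum
  simpa using hsum

variable {p : ℕ} [Fact p.Prime] {f : (ZMod p)[X]}

theorem two_mul_card_filter_eval_pow_eq_one_le (hf : ∀ c g, f ≠ C c * g ^ 2)
    (hf0 : f.eval 0 ≠ 0) (ht : 13 ≤ p.sqrt) (hdeg : f.natDegree ≤ p.sqrt) :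
    2 * (Finset.univ.filter fun x : ZMod p => f.eval x ^ (p / 2) = 1).card ≤
      p + 11 * f.natDegree * p.sqrt := by
  have hm : 1 ≤ f.natDegree := natDegree_pos_of_forall_ne_C_mul_sq hf
  have hp_lower : p.sqrt * p.sqrt ≤ p := Nat.sqrt_le p
  have hp_upper : p ≤ p.sqrt * p.sqrt + p.sqrt + p.sqrt := Nat.sqrt_le_add p
  -- With `K ≈ p / 2`, the leading terms of the dimension count only need `J > M / 2`, which makes
  -- `p * J / M`, the leading term of the bound, equal to `p / 2`. The excess `8 m` absorbs the
  -- rest.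
  have hbound := mul_card_filter_eval_pow_eq_one_le (M := 2 * p.sqrt)
    (J := p.sqrt + 8 * f.natDegree) (K := (p + 1 - f.natDegree) / 2)
    (by rintro rfl; norm_num at ht) hf hf0
  generalize (Finset.univ.filter fun x : ZMod p => f.eval x ^ (p / 2) = 1).card = N at *
  generalize f.natDegree = m at *
  generalize p.sqrt = t at *
  have htt : 13 * t ≤ t * t := Nat.mul_le_mul_right _ ht
  obtain ⟨K, hK⟩ : ∃ K, (p + 1 - m) / 2 = K := ⟨_, rfl⟩
  rw [hK] at hbound
  have hK_lower : p ≤ 2 * K + m := by omega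
  have hdim : 2 * t * (K + 2 * t * m + (t + 8 * m)) < 2 * ((t + 8 * m) * K) := by
    nlinarith
  have hcount : 2 * t * N ≤ (2 * t + p / 2) * m + K + p * (t + 8 * m) :=
    hbound (by omega) (by omega) hdim
  have hcount' : 4 * t * N ≤ 4 * t * m + p * m + (p + 1) + 2 * p * (t + 8 * m) := by
    have : p / 2 * 2 * m ≤ p * m := Nat.mul_le_mul_right _ (Nat.div_mul_le_self p 2)
    nlinarith [show 2 * K ≤ p + 1 by omega]
  refine Nat.le_of_mul_le_mul_left (c := 2 * t) ?_ (by omega)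
  nlinarith

theorem sum_quadraticChar_eval_le_of_eval_zero_ne (hf : ∀ c g, f ≠ C c * g ^ 2)
    (hf0 : f.eval 0 ≠ 0) (ht : 13 ≤ p.sqrt) (hdeg : f.natDegree ≤ p.sqrt) :
    ∑ x : ZMod p, quadraticChar (ZMod p) (f.eval x) ≤ 12 * f.natDegree * p.sqrt := by
  have hp : p ≠ 2 := by rintro rfl; norm_num at ht
  have hsquares : (Finset.univ.filter fun x => quadraticChar (ZMod p) (f.eval x) = 1).card ≤
      (Finset.univ.filter fun x : ZMod p => f.eval x ^ (p / 2) = 1).card := by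
    refine Finset.card_le_card <| Finset.monotone_filter_right _ fun x _ hx => ?_
    have heuler := quadraticChar_eq_pow_of_char_ne_two' (F := ZMod p)
      (by rwa [ZMod.ringChar_zmod_n]) (f.eval x)
    rw [hx, ZMod.card, Int.cast_one] at heuler
    exact heuler.symm
  have hroots : (Finset.univ.filter fun x => f.eval x = 0).card ≤ f.natDegree := by
    refine card_le_degree_of_subset_roots fun x hx => ?_
    exact (mem_roots (by rintro rfl; simp at hf0)).mpr (Finset.mem_filter.mp hx).2
  have hsum := sum_quadraticChar_add_card fun x => f.eval x
  have hcount := two_mul_card_filter_eval_pow_eq_one_le hf hf0 ht hdeg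
  rw [ZMod.card] at hsum
  zify at hsquares hroots hcount ht
  nlinarith

theorem sum_quadraticChar_eval_le (hf : ∀ c g, f ≠ C c * g ^ 2)
    (ht : 13 ≤ p.sqrt) (hdeg : f.natDegree ≤ p.sqrt) :
    ∑ x : ZMod p, quadraticChar (ZMod p) (f.eval x) ≤ 12 * f.natDegree * p.sqrt := by
  by_cases hzero : ∀ a, f.eval a = 0
  · simp only [hzero, quadraticChar_zero, Finset.sum_const_zero]
    positivity
  · push Not at hzero
    obtain ⟨a, ha⟩ := hzero
    have hshift (c : ZMod p) (g : (ZMod p)[X]) : taylor a f ≠ C c * g ^ 2 := fun h => by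
      refine hf c (taylor (-a) g) ?_
      have := congrArg (taylor (-a)) h
      rwa [taylor_taylor, neg_add_cancel, taylor_zero, taylor_mul, taylor_C, taylor_pow] at this
    have hbound := sum_quadraticChar_eval_le_of_eval_zero_ne hshift
      (by simpa [taylor_eval] using ha) ht (by rwa [natDegree_taylor])
    simp only [taylor_eval, natDegree_taylor] at hbound
    rw [← Equiv.sum_comp (Equiv.addRight a)]
    exact hbound

theorem abs_sum_quadraticChar_eval_le_of_natDegree_le (hf : ∀ c g, f ≠ C c * g ^ 2)
    (ht : 13 ≤ p.sqrt) (hdeg : f.natDegree ≤ p.sqrt) :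
    |∑ x : ZMod p, quadraticChar (ZMod p) (f.eval x)| ≤ 12 * f.natDegree * p.sqrt := by
  have hp : p ≠ 2 := by rintro rfl; norm_num at ht
  obtain ⟨n, hn⟩ := quadraticChar_exists_neg_one (F := ZMod p) (by rwa [ZMod.ringChar_zmod_n])
  have hn0 : n ≠ 0 := by rintro rfl; simp at hn
  have hnf (c : ZMod p) (g : (ZMod p)[X]) : C n * f ≠ C c * g ^ 2 := fun h => by
    refine hf (n⁻¹ * c) g ?_
    rw [C_mul, mul_assoc, ← h, ← mul_assoc, ← C_mul, inv_mul_cancel₀ hn0, C_1, one_mul]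
  have hneg := sum_quadraticChar_eval_le hnf ht (by rwa [natDegree_C_mul hn0])
  simp only [eval_mul, eval_C, map_mul, hn, neg_one_mul, Finset.sum_neg_distrib,
    natDegree_C_mul hn0] at hneg
  exact abs_le'.mpr ⟨sum_quadraticChar_eval_le hf ht hdeg, hneg⟩

theorem abs_sum_quadraticChar_le_card {F ι : Type*} [Field F] [Fintype F] [DecidableEq F]
    [Fintype ι] (g : ι → F) : |∑ i, quadraticChar F (g i)| ≤ Fintype.card ι := by
  refine (Finset.abs_sum_le_sum_abs _ _).trans ?_
  refine (Finset.sum_le_card_nsmul _ _ 1 fun i _ => ?_).trans (by simp)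
  rcases quadraticChar_isQuadratic F (g i) with h | h | h <;> simp [h]

/-- Weil's bound, with `13` in place of the optimal constant `1`. -/
theorem abs_sum_quadraticChar_eval_le (hf : ∀ c g, f ≠ C c * g ^ 2) :
    |((∑ x : ZMod p, quadraticChar (ZMod p) (f.eval x) : ℤ) : ℝ)| ≤
      13 * f.natDegree * √p := by
  have hm : (1 : ℝ) ≤ f.natDegree := by
    exact_mod_cast natDegree_pos_of_forall_ne_C_mul_sq hf
  have hsq : √p * √p = (p : ℝ) := Real.mul_self_sqrt p.cast_nonneg
  have hs0 : 0 ≤ √(p : ℝ) := Real.sqrt_nonneg _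
  have hs : √(p : ℝ) ≤ p.sqrt + 1 := Real.real_sqrt_le_nat_sqrt_succ
  have htriv : |((∑ x : ZMod p, quadraticChar (ZMod p) (f.eval x) : ℤ) : ℝ)| ≤ p := by
    have := abs_sum_quadraticChar_le_card fun x : ZMod p => f.eval x
    rw [ZMod.card] at this
    exact_mod_cast this
  rcases lt_or_ge p.sqrt 13 with ht | ht
  · have : (p.sqrt : ℝ) + 1 ≤ 13 := by exact_mod_cast ht
    nlinarith
  rcases lt_or_ge p.sqrt f.natDegree with hdeg | hdeg
  · have : (p.sqrt : ℝ) + 1 ≤ f.natDegree := by exact_mod_cast hdeg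
    nlinarith
  · calc |((∑ x : ZMod p, quadraticChar (ZMod p) (f.eval x) : ℤ) : ℝ)|
        ≤ 12 * f.natDegree * (p.sqrt : ℝ) := by
          exact_mod_cast abs_sum_quadraticChar_eval_le_of_natDegree_le hf ht hdeg
      _ ≤ 13 * f.natDegree * √p := by
          gcongr
          · norm_num
          · exact Real.nat_sqrt_le_real_sqrt

end Weil

section SignPatterns

theorem prod_X_add_C_ne_C_mul_sq {F : Type*} [Field F] {S : Finset F} (hS : S.Nonempty) (c : F)
    (g : F[X]) : ∏ s ∈ S, (X + C s) ≠ C c * g ^ 2 := fun h => by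
  have hprod : ∏ s ∈ S, (X + C s) = ∏ s ∈ S, (X - C (-s)) := by simp
  have hsep : (∏ s ∈ S, (X + C s)).Separable := by
    rw [hprod, separable_prod_X_sub_C_iff']
    exact fun x _ y _ => neg_inj.mp
  have hunit : IsUnit g := hsep.squarefree g ⟨C c, by rw [h]; ring⟩
  have hdeg : (∏ s ∈ S, (X + C s)).natDegree = S.card := by
    rw [hprod, natDegree_finsetProd_X_sub_C_eq_card]
  obtain ⟨u, -, rfl⟩ := isUnit_iff.mp hunit
  rw [h, ← C_pow, ← C_mul, natDegree_C] at hdeg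
  exact hS.card_pos.ne hdeg

variable {p : ℕ} [Fact p.Prime]

theorem abs_sum_quadraticChar_prod_add_le {T : Finset (ZMod p)} (hT : T.Nonempty) :
    |((∑ x : ZMod p, quadraticChar (ZMod p) (∏ s ∈ T, (x + s)) : ℤ) : ℝ)| ≤
      13 * T.card * √p := by
  have hdeg : (∏ s ∈ T, (X + C s)).natDegree = T.card := by
    rw [natDegree_prod_of_monic _ _ fun s _ => monic_X_add_C s]
    simp
  simpa only [eval_prod, eval_add, eval_X, eval_C, hdeg] using
    abs_sum_quadraticChar_eval_le (prod_X_add_C_ne_C_mul_sq hT)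

theorem sum_prod_one_add_mul_quadraticChar_le (S : Finset (ZMod p)) (ε : ZMod p → ℤˣ) :
    ((∑ x : ZMod p, ∏ s ∈ S, (1 + ε s * quadraticChar (ZMod p) (x + s)) : ℤ) : ℝ) ≤
      p + 2 ^ S.card * (13 * S.card * √p) := by
  have hexpand : ∑ x : ZMod p, ∏ s ∈ S, (1 + ε s * quadraticChar (ZMod p) (x + s)) =
      ∑ T ∈ S.powerset, ((∏ s ∈ T, ε s : ℤˣ) : ℤ) *
        ∑ x : ZMod p, quadraticChar (ZMod p) (∏ s ∈ T, (x + s)) := by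
    simp only [Finset.prod_one_add, Finset.prod_mul_distrib, map_prod, Units.coe_prod,
      Finset.mul_sum]
    exact Finset.sum_comm
  have hterm (T : Finset (ZMod p)) (hT : T ∈ S.powerset) :
      ((((∏ s ∈ T, ε s : ℤˣ) : ℤ) *
        ∑ x : ZMod p, quadraticChar (ZMod p) (∏ s ∈ T, (x + s)) : ℤ) : ℝ) ≤
      (if T = ∅ then (p : ℝ) else 0) + 13 * S.card * √p := by
    rcases T.eq_empty_or_nonempty with rfl | hne
    · simp only [Finset.prod_empty, Units.val_one, one_mul, map_one, Finset.sum_const,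
        Finset.card_univ, ZMod.card, nsmul_one, Int.cast_natCast, if_true]
      exact le_add_of_nonneg_right (by positivity)
    · rw [if_neg hne.ne_empty, zero_add]
      refine (le_abs_self _).trans ?_
      rw [← Int.cast_abs, abs_mul, Int.isUnit_iff_abs_eq.mp (Units.isUnit _), one_mul, Int.cast_abs]
      refine (abs_sum_quadraticChar_prod_add_le hne).trans ?_
      gcongr
      exact Finset.mem_powerset.mp hT
  rw [hexpand, Int.cast_sum]
  refine (Finset.sum_le_sum hterm).trans_eq ?_
  rw [Finset.sum_add_distrib, Finset.sum_ite_eq', if_pos (Finset.empty_mem_powerset S),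
    Finset.sum_const, Finset.card_powerset, nsmul_eq_mul]
  norm_cast

theorem two_pow_mul_card_filter_quadraticChar_eq_le (S : Finset (ZMod p)) (ε : ZMod p → ℤˣ) :
    (2 ^ S.card * (Finset.univ.filter fun x =>
        ∀ s ∈ S, quadraticChar (ZMod p) (x + s) = ε s).card : ℝ) ≤
      p + 2 ^ S.card * (13 * S.card * √p) := by
  refine le_trans ?_ (sum_prod_one_add_mul_quadraticChar_le S ε)
  norm_cast
  push_cast [Finset.natCast_card_filter]
  rw [Finset.mul_sum]
  refine Finset.sum_le_sum fun x _ => ?_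
  split_ifs with hx
  · refine le_of_eq ?_
    rw [mul_one, ← Finset.prod_const]
    refine Finset.prod_congr rfl fun s hs => ?_
    rw [hx s hs, Int.units_coe_mul_self, one_add_one_eq_two]
  · rw [mul_zero]
    refine Finset.prod_nonneg fun s _ => ?_
    rcases Int.units_eq_one_or (ε s) with hε | hε <;>
      rcases quadraticChar_isQuadratic (ZMod p) (x + s) with h | h | h <;> simp [hε, h]

/-- The `x` such that the quadratic character is constantly `ε` on the block
`x, x + 1, …, x + (h - 1)`. -/
def constantRunStarts (p h : ℕ) [Fact p.Prime] (ε : ℤˣ) : Finset (ZMod p) :=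
  Finset.univ.filter fun x => ∀ j < h, quadraticChar (ZMod p) (x + j) = ε

theorem card_constantRunStarts_le {h : ℕ} (hle : h ≤ p) (hp : p ≤ 2 ^ h) (ε : ℤˣ) :
    ((constantRunStarts p h ε).card : ℝ) ≤ 1 + 13 * h * √p := by
  have hcard : ((Finset.range h).image (Nat.cast : ℕ → ZMod p)).card = h := by
    rw [Finset.card_image_of_injOn, Finset.card_range]
    exact (CharP.natCast_injOn_Iio (ZMod p) p).mono fun j hj =>
      (Finset.mem_range.mp hj).trans_le hle
  have hbound := two_pow_mul_card_filter_quadraticChar_eq_le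
    ((Finset.range h).image (Nat.cast : ℕ → ZMod p)) fun _ => ε
  simp only [hcard, Finset.forall_mem_image, Finset.mem_range] at hbound
  have hp' : (p : ℝ) ≤ 2 ^ h := by exact_mod_cast hp
  refine le_of_mul_le_mul_left (hbound.trans ?_) (by positivity : (0 : ℝ) < 2 ^ h)
  linarith

end SignPatterns

section ReducedPairs

theorem card_filter_dvd_add_mul_le {u w : ℤ} (huw : IsCoprime u w) (L l : ℕ) :
    ((Finset.range L).filter fun i : ℕ => (l : ℤ) ∣ u + i * w).card ≤ L / l + 1 := by
  rw [← Finset.card_range (L / l + 1)]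
  refine Finset.card_le_card_of_injOn (· / l) (fun i hi => ?_) fun i hi i' hi' hdiv => ?_
  · rw [Finset.mem_coe, Finset.mem_filter, Finset.mem_range] at hi
    exact Finset.mem_coe.mpr <| Finset.mem_range.mpr <|
      Nat.lt_succ_of_le (Nat.div_le_div_right hi.1.le)
  · have hdvd : (l : ℤ) ∣ u + i * w := (Finset.mem_filter.mp hi).2
    have hdvd' : (l : ℤ) ∣ u + i' * w := (Finset.mem_filter.mp hi').2
    have hlw : IsCoprime (l : ℤ) w := (huw.add_mul_right_left (i : ℤ)).of_isCoprime_of_dvd_left hdvd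
    have hmod : i' % l = i % l := by
      refine Nat.modEq_iff_dvd.mpr (hlw.dvd_of_dvd_mul_right ?_)
      rw [sub_mul, ← add_sub_add_left_eq_sub _ _ u]
      exact dvd_sub hdvd hdvd'
    rw [← Nat.div_add_mod i l, ← Nat.div_add_mod i' l, hmod, show i / l = i' / l from hdiv]

theorem sum_Icc_two_inv_sq_le (Q : ℕ) : ∑ l ∈ Finset.Icc 2 Q, ((l : ℝ) ^ 2)⁻¹ ≤ 3 / 4 := by
  rcases lt_or_ge Q 2 with hQ | hQ
  · rw [Finset.Icc_eq_empty_of_lt hQ]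
    norm_num
  · rw [← Finset.add_sum_Ioc_eq_sum_Icc hQ]
    have htail := sum_Ioc_inv_sq_le_sub (α := ℝ) two_ne_zero hQ
    have hQ0 : (0 : ℝ) ≤ (Q : ℝ)⁻¹ := by positivity
    push_cast at htail ⊢
    linarith

theorem sum_Icc_two_div_add_one_mul_div_le {L Q : ℕ} (hL : 6 * Q ≤ L) :
    ((∑ l ∈ Finset.Icc 2 Q, (L / l + 1) * (Q / l) : ℕ) : ℝ) ≤ 7 / 8 * (L * Q) := by
  calc ((∑ l ∈ Finset.Icc 2 Q, (L / l + 1) * (Q / l) : ℕ) : ℝ)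
      ≤ ∑ l ∈ Finset.Icc 2 Q, 7 / 6 * (L * Q) * ((l : ℝ) ^ 2)⁻¹ := by
        push_cast
        refine Finset.sum_le_sum fun l hl => ?_
        rw [Finset.mem_Icc] at hl
        have hl0 : (0 : ℝ) < l := by exact_mod_cast (by omega : 0 < l)
        have hone : (1 : ℝ) ≤ 1 / 6 * (L / l) := by
          have : (6 * l : ℝ) ≤ L := by exact_mod_cast (by omega : 6 * l ≤ L)
          rw [← mul_div_assoc, le_div_iff₀ hl0]
          linarith
        calc (((L / l : ℕ) : ℝ) + 1) * ((Q / l : ℕ) : ℝ)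
            ≤ (L / l + 1 / 6 * (L / l)) * (Q / l) := by gcongr <;> exact Nat.cast_div_le
          _ = 7 / 6 * (L * Q) * ((l : ℝ) ^ 2)⁻¹ := by field
    _ = 7 / 6 * (L * Q) * ∑ l ∈ Finset.Icc 2 Q, ((l : ℝ) ^ 2)⁻¹ := by rw [Finset.mul_sum]
    _ ≤ 7 / 6 * (L * Q) * (3 / 4) := by gcongr; exact sum_Icc_two_inv_sq_le Q
    _ = 7 / 8 * (L * Q) := by ring

/-- The pairs `(i, q)` with `i < L` and `1 ≤ q ≤ Q` for which the fraction `(u + i * w) / q` is in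
lowest terms. -/
def reducedPairs (u w : ℤ) (L Q : ℕ) : Finset (ℕ × ℕ) :=
  (Finset.range L ×ˢ Finset.Icc 1 Q).filter fun z => Int.gcd (u + z.1 * w) z.2 = 1

theorem mem_reducedPairs {u w : ℤ} {L Q : ℕ} {z : ℕ × ℕ} :
    z ∈ reducedPairs u w L Q ↔
      (z.1 < L ∧ 1 ≤ z.2 ∧ z.2 ≤ Q) ∧ Int.gcd (u + z.1 * w) z.2 = 1 := by
  rw [reducedPairs, Finset.mem_filter, Finset.mem_product, Finset.mem_range, Finset.mem_Icc]

theorem card_filter_gcd_ne_one_le {u w : ℤ} (huw : IsCoprime u w) (L Q : ℕ) :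
    ((Finset.range L ×ˢ Finset.Icc 1 Q).filter
        fun z : ℕ × ℕ => ¬ Int.gcd (u + z.1 * w) z.2 = 1).card ≤
      ∑ l ∈ Finset.Icc 2 Q, (L / l + 1) * (Q / l) := by
  have hcover : ((Finset.range L ×ˢ Finset.Icc 1 Q).filter
      fun z : ℕ × ℕ => ¬ Int.gcd (u + z.1 * w) z.2 = 1) ⊆
      (Finset.Icc 2 Q).biUnion fun l => ((Finset.range L).filter fun i : ℕ =>
        (l : ℤ) ∣ u + i * w) ×ˢ ((Finset.Ioc 0 Q).filter (l ∣ ·)) := by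
    rintro ⟨i, q⟩ hz
    simp only [Finset.mem_filter, Finset.mem_product, Finset.mem_range, Finset.mem_Icc] at hz
    obtain ⟨⟨hi, hq1, hqQ⟩, hgcd⟩ := hz
    have hdvd : Int.gcd (u + i * w) q ∣ q :=
      Int.natCast_dvd_natCast.mp (Int.gcd_dvd_right (u + i * w) q)
    have hle := Nat.le_of_dvd hq1 hdvd
    have hpos := Nat.pos_of_dvd_of_pos hdvd hq1
    simp only [Finset.mem_biUnion, Finset.mem_product, Finset.mem_filter, Finset.mem_range,
      Finset.mem_Icc, Finset.mem_Ioc]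
    exact ⟨_, ⟨by omega, hle.trans hqQ⟩, ⟨hi, Int.gcd_dvd_left _ _⟩, ⟨hq1, hqQ⟩, hdvd⟩
  refine (Finset.card_le_card hcover).trans (Finset.card_biUnion_le.trans ?_)
  refine Finset.sum_le_sum fun l _ => ?_
  rw [Finset.card_product, Nat.Ioc_filter_dvd_card_eq_div]
  exact Nat.mul_le_mul_right _ (card_filter_dvd_add_mul_le huw L l)

theorem mul_le_card_reducedPairs {u w : ℤ} (huw : IsCoprime u w) {L Q : ℕ} (hL : 6 * Q ≤ L) :
    L * Q ≤ 8 * (reducedPairs u w L Q).card := by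
  have htotal := Finset.card_filter_add_card_filter_not (s := Finset.range L ×ˢ Finset.Icc 1 Q)
    (fun z : ℕ × ℕ => Int.gcd (u + z.1 * w) z.2 = 1)
  rw [Finset.card_product, Finset.card_range, Nat.card_Icc, Nat.add_sub_cancel,
    ← reducedPairs] at htotal
  have hbad := (Nat.cast_le (α := ℝ)).mpr (card_filter_gcd_ne_one_le huw L Q) |>.trans
    (sum_Icc_two_div_add_one_mul_div_le hL)
  rw [← Nat.cast_le (α := ℝ)]
  have htotal' := congrArg (Nat.cast (R := ℝ)) htotal
  push_cast at htotal' ⊢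
  linarith

theorem eq_of_mem_reducedPairs_of_mul_eq {u w : ℤ} (hw : w ≠ 0) {L Q : ℕ} {z z' : ℕ × ℕ}
    (hz : z ∈ reducedPairs u w L Q) (hz' : z' ∈ reducedPairs u w L Q)
    (h : (u + z.1 * w) * z'.2 = (u + z'.1 * w) * z.2) : z = z' := by
  rw [mem_reducedPairs] at hz hz'
  have hdvd : (z.2 : ℤ) ∣ z'.2 :=
    (Int.isCoprime_iff_gcd_eq_one.mpr hz.2).symm.dvd_of_dvd_mul_left (h ▸ dvd_mul_left _ _)
  have hdvd' : (z'.2 : ℤ) ∣ z.2 :=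
    (Int.isCoprime_iff_gcd_eq_one.mpr hz'.2).symm.dvd_of_dvd_mul_left (h ▸ dvd_mul_left _ _)
  have hsnd : z.2 = z'.2 :=
    Nat.dvd_antisymm (Int.natCast_dvd_natCast.mp hdvd) (Int.natCast_dvd_natCast.mp hdvd')
  have hq : (z'.2 : ℤ) ≠ 0 := by omega
  rw [hsnd] at h
  have hfst : (z.1 : ℤ) = z'.1 := mul_right_cancel₀ hw (add_left_cancel (mul_right_cancel₀ hq h))
  exact Prod.ext (by exact_mod_cast hfst) hsnd

end ReducedPairs

section Fractions

theorem natCast_ne_zero_of_pos_of_lt {m n : ℕ} (hm : 0 < m) (hmn : m < n) :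
    (m : ZMod n) ≠ 0 := by
  rw [Ne, ZMod.natCast_eq_zero_iff]
  exact Nat.not_dvd_of_pos_of_lt hm hmn

variable {p : ℕ} [Fact p.Prime]

theorem exists_isCoprime_intCast_eq_mul (a : ZMod p) {n : ℕ} (hn : 0 < n) (hnp : n < p) :
    ∃ u w : ℤ, IsCoprime u w ∧ 0 < w ∧ w ≤ n ∧ |u| * (n + 1) ≤ p ∧ (u : ZMod p) = w * a := by
  obtain ⟨r, hr, hrn⟩ := Real.exists_rat_abs_sub_le_and_den_le ((a.val : ℝ) / p) hn
  have hp0 : (0 : ℝ) < p := by exact_mod_cast (Fact.out : p.Prime).pos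
  have hden : (0 : ℝ) < r.den := by exact_mod_cast r.den_pos
  refine ⟨r.den * a.val - r.num * p, r.den, ?_, by exact_mod_cast r.den_pos, by exact_mod_cast hrn,
    ?_, ?_⟩
  · have hnum : IsCoprime r.num r.den := Int.isCoprime_iff_nat_coprime.mpr r.reduced
    have hp : IsCoprime (p : ℤ) r.den := Nat.isCoprime_iff_coprime.mpr <|
      Nat.coprime_of_lt_prime r.den_nz (hrn.trans_lt hnp) Fact.out
    rw [sub_eq_neg_add]
    exact (hnum.mul_left hp).neg_left.add_mul_left_left _
  · have habs : |(r.den : ℝ) * a.val - r.num * p| = |(a.val : ℝ) / p - r| * (r.den * p) := by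
      rw [← abs_of_pos (mul_pos hden hp0), ← abs_mul, Rat.cast_def r]
      congr 1
      field
    have : |(r.den : ℝ) * a.val - r.num * p| * (n + 1) ≤ p := by
      rw [habs]
      calc |(a.val : ℝ) / p - r| * (r.den * p) * (n + 1)
          ≤ 1 / ((n + 1) * r.den) * (r.den * p) * (n + 1) := by gcongr
        _ = p := by field
    exact_mod_cast this
  · push_cast
    rw [ZMod.natCast_zmod_val, CharP.cast_eq_zero (ZMod p) p, mul_zero, sub_zero]

theorem abs_add_mul_mul_sub_le {u w : ℤ} (hw : 0 ≤ w) {L Q i i' q q' : ℕ} (hi : i ≤ L)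
    (hi' : i' ≤ L) (hq : q ≤ Q) (hq' : q' ≤ Q) :
    |(u + i * w) * q' - (u + i' * w) * q| ≤ |u| * Q + w * (L * Q) := by
  have hqq : |(q' : ℤ) - q| ≤ Q := by rw [abs_le]; constructor <;> omega
  have hiq : |((i * q' : ℕ) : ℤ) - (i' * q : ℕ)| ≤ (L * Q : ℕ) := by
    have := Nat.mul_le_mul hi hq'
    have := Nat.mul_le_mul hi' hq
    rw [abs_le]; constructor <;> omega
  push_cast at hiq
  calc |(u + i * w) * q' - (u + i' * w) * q|
      = |u * (q' - q) + w * (i * q' - i' * q)| := by congr 1; ring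
    _ ≤ |u| * |(q' : ℤ) - q| + w * |(i : ℤ) * q' - i' * q| := by
        refine (abs_add_le _ _).trans_eq ?_
        rw [abs_mul, abs_mul, abs_of_nonneg hw]
    _ ≤ |u| * Q + w * (L * Q) := by gcongr

theorem injOn_add_div_reducedPairs {a : ZMod p} {u w : ℤ} (hua : (u : ZMod p) = w * a)
    (hw : 0 < w) {L Q : ℕ} (hQ : Q < p) (hp : |u| * Q + w * (L * Q) < p) :
    Set.InjOn (fun z : ℕ × ℕ => (a + z.1) / (z.2 : ZMod p)) (reducedPairs u w L Q) := by
  rintro ⟨i, q⟩ hz ⟨i', q'⟩ hz' h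
  obtain ⟨⟨hi, hq0, hq⟩, -⟩ := mem_reducedPairs.mp hz
  obtain ⟨⟨hi', hq0', hq'⟩, -⟩ := mem_reducedPairs.mp hz'
  dsimp only at h hi hq0 hq hi' hq0' hq'
  rw [div_eq_div_iff (natCast_ne_zero_of_pos_of_lt hq0 (hq.trans_lt hQ))
    (natCast_ne_zero_of_pos_of_lt hq0' (hq'.trans_lt hQ))] at h
  refine eq_of_mem_reducedPairs_of_mul_eq hw.ne' hz hz' (sub_eq_zero.mp ?_)
  refine Int.eq_zero_of_abs_lt_dvd (m := p) ?_
    ((abs_add_mul_mul_sub_le hw.le hi.le hi'.le hq hq').trans_lt hp)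
  rw [← ZMod.intCast_zmod_eq_zero_iff_dvd]
  push_cast
  rw [hua]
  linear_combination (w : ZMod p) * h

theorem add_div_mem_constantRunStarts {h N i q : ℕ} {a : ZMod p}
    (hrun : ∀ i < N, quadraticChar (ZMod p) (a + i) = 1) (hi : i + h * q ≤ N)
    (hq : (q : ZMod p) ≠ 0) :
    (a + i) / q ∈ constantRunStarts p h 1 ∪ constantRunStarts p h (-1) := by
  have hq0 : 0 < q := Nat.pos_of_ne_zero (by rintro rfl; simp at hq)
  have hχ (j : ℕ) (hj : j < h) :
      quadraticChar (ZMod p) q * quadraticChar (ZMod p) ((a + i) / q + j) = 1 := by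
    rw [← map_mul, mul_add, mul_div_cancel₀ _ hq, add_assoc]
    exact_mod_cast hrun (i + q * j) (by nlinarith)
  simp only [constantRunStarts, Finset.mem_union, Finset.mem_filter_univ]
  refine (quadraticChar_dichotomy hq).imp (fun h1 j hj => ?_) fun h1 j hj => ?_
  · simpa [h1] using hχ j hj
  · simpa [h1, neg_eq_iff_eq_neg] using hχ j hj

theorem mul_le_card_constantRunStarts {h L Q : ℕ} {a : ZMod p}
    (hrun : ∀ i < L + h * Q, quadraticChar (ZMod p) (a + i) = 1) (hQ : 0 < Q) (hLQ : 6 * Q ≤ L)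
    (hL : 8 * (L * Q ^ 2) ≤ p) :
    L * Q ≤ 8 * ((constantRunStarts p h 1).card + (constantRunStarts p h (-1)).card) := by
  have hQp : 4 * Q < p := by nlinarith
  obtain ⟨u, w, huw, hw, hwQ, hu, hua⟩ :=
    exists_isCoprime_intCast_eq_mul a (n := 4 * Q) (by omega) hQp
  refine (mul_le_card_reducedPairs huw hLQ).trans (Nat.mul_le_mul_left 8 ?_)
  refine le_trans ?_ (Finset.card_union_le _ _)
  refine Finset.card_le_card_of_injOn _ (fun z hz => ?_)
    (injOn_add_div_reducedPairs hua hw (by omega) ?_)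
  · obtain ⟨⟨hi, hq0, hq⟩, -⟩ := mem_reducedPairs.mp hz
    refine add_div_mem_constantRunStarts hrun
      (add_le_add hi.le (Nat.mul_le_mul_left h hq)) (natCast_ne_zero_of_pos_of_lt hq0 (by omega))
  · zify at hL hQ
    push_cast at hwQ hu
    have : w * (L * Q) ≤ 4 * Q * (L * Q) := by gcongr
    nlinarith [abs_nonneg u]

end Fractions

section LongestRun

theorem not_forall_quadraticChar_add_eq_one {p : ℕ} [Fact p.Prime] {h Q : ℕ} (hph : p ≤ 2 ^ h)
    (hQ : 0 < Q) (hpQ : √p ≤ 4 * (Q : ℝ) ^ 2) (hhQ : 8000 * (h * Q ^ 3) ≤ p) (a : ZMod p) :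
    ¬ ∀ i < 900 * (h * Q), quadraticChar (ZMod p) (a + i) = 1 := by
  intro hrun
  have hh : 1 ≤ h := by
    have := hph.trans_lt' (Fact.out : p.Prime).one_lt
    exact Nat.pos_of_ne_zero (by rintro rfl; simp at this)
  have hhp : h ≤ p := by nlinarith [Nat.one_le_pow 3 Q hQ]
  have hlower : 899 * (h * Q) * Q ≤
      8 * ((constantRunStarts p h 1).card + (constantRunStarts p h (-1)).card) :=
    mul_le_card_constantRunStarts (fun i hi => hrun i (by linarith)) hQ (by nlinarith)
      (by nlinarith)
  have hlower' : 899 * ((h : ℝ) * Q) * Q ≤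
      8 * ((constantRunStarts p h 1).card + (constantRunStarts p h (-1)).card) := by
    exact_mod_cast hlower
  have hhQ2 : (1 : ℝ) ≤ h * Q ^ 2 := by exact_mod_cast Nat.mul_pos hh (pow_pos hQ 2)
  have hsqrt : h * √p ≤ h * (4 * (Q : ℝ) ^ 2) := by gcongr
  linarith [card_constantRunStarts_le hhp hph 1, card_constantRunStarts_le hhp hph (-1)]

theorem longestResidueRun_le_of_forall_not {p n : ℕ} [Fact p.Prime]
    (h : ∀ a : ZMod p, ¬ ∀ i < n, quadraticChar (ZMod p) (a + i) = 1) :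
    longestResidueRun p ≤ n := by
  by_contra! hlt
  obtain ⟨a, ha⟩ := (longestResidueRun_isGreatest p Fact.out).1
  refine h a fun i hi => ?_
  obtain ⟨x, hx, hxa⟩ := ha i (hi.trans hlt)
  rw [hxa, quadraticChar_sq_one' hx]

theorem longestResidueRun_le_of_clog_le {p : ℕ} [Fact p.Prime]
    (hp : 8000 * (Nat.clog 2 p : ℝ) ≤ (p : ℝ) ^ (1 / 4 : ℝ)) :
    (longestResidueRun p : ℝ) ≤ 900 * (Nat.clog 2 p * (p : ℝ) ^ (1 / 4 : ℝ)) := by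
  have hpow : ((p : ℝ) ^ (1 / 4 : ℝ)) ^ 4 = p := by
    rw [← Real.rpow_mul_natCast p.cast_nonneg]
    norm_num
  have hroot : 1 ≤ (p : ℝ) ^ (1 / 4 : ℝ) :=
    Real.one_le_rpow (by exact_mod_cast (Fact.out : p.Prime).one_le) (by norm_num)
  set r := (p : ℝ) ^ (1 / 4 : ℝ)
  have hQr : (⌊r⌋₊ : ℝ) ≤ r := Nat.floor_le (by linarith)
  have hrQ : r ≤ 2 * ⌊r⌋₊ := by
    have : (1 : ℝ) ≤ ⌊r⌋₊ := by exact_mod_cast Nat.floor_pos.mpr hroot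
    linarith [Nat.lt_floor_add_one r]
  have hsqrt : √p ≤ 4 * (⌊r⌋₊ : ℝ) ^ 2 :=
    calc √p = r ^ 2 := by
          rw [← hpow, show r ^ 4 = (r ^ 2) ^ 2 by ring, Real.sqrt_sq (by positivity)]
      _ ≤ (2 * ⌊r⌋₊) ^ 2 := by gcongr
      _ = 4 * (⌊r⌋₊ : ℝ) ^ 2 := by ring
  have hcube : 8000 * (Nat.clog 2 p * ⌊r⌋₊ ^ 3) ≤ p := by
    rw [← Nat.cast_le (α := ℝ), ← hpow]
    push_cast
    calc 8000 * (Nat.clog 2 p * (⌊r⌋₊ : ℝ) ^ 3) = 8000 * Nat.clog 2 p * (⌊r⌋₊ : ℝ) ^ 3 := by ring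
      _ ≤ r * r ^ 3 := by gcongr
      _ = r ^ 4 := by ring
  calc (longestResidueRun p : ℝ) ≤ 900 * (Nat.clog 2 p * ⌊r⌋₊) := by
        exact_mod_cast longestResidueRun_le_of_forall_not <| not_forall_quadraticChar_add_eq_one
          (Nat.le_pow_clog one_lt_two p) (Nat.floor_pos.mpr hroot) hsqrt hcube
    _ ≤ 900 * (Nat.clog 2 p * r) := by gcongr

theorem natCast_clog_two_le {n : ℕ} (hn : 2 ≤ n) : (Nat.clog 2 n : ℝ) ≤ 2 * Real.logb 2 n := by
  have hlog : 1 ≤ Real.logb 2 n := by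
    rw [Real.le_logb_iff_rpow_le one_lt_two (by positivity), Real.rpow_one]
    exact_mod_cast hn
  have hceil := Nat.ceil_lt_add_one (zero_le_one.trans hlog)
  rw [← Nat.cast_ofNat (R := ℝ) (n := 2), Real.natCeil_logb_natCast] at hceil
  push_cast at hceil
  linarith

open Asymptotics Filter

theorem isLittleO_clog_two_rpow {s : ℝ} (hs : 0 < s) :
    (fun n : ℕ => (Nat.clog 2 n : ℝ)) =o[atTop] fun n => (n : ℝ) ^ s := by
  have hclog : (fun n : ℕ => (Nat.clog 2 n : ℝ)) =O[atTop] fun n => Real.logb 2 n :=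
    .of_bound 2 <| (eventually_ge_atTop 2).mono fun n hn => by
      rw [Real.norm_natCast]
      exact (natCast_clog_two_le hn).trans
        (mul_le_mul_of_nonneg_left (Real.le_norm_self _) zero_le_two)
  refine hclog.trans_isLittleO ?_
  simp only [Real.logb, div_eq_inv_mul]
  exact ((isLittleO_log_rpow_atTop hs).comp_tendsto tendsto_natCast_atTop_atTop).const_mul_left _

theorem isBigO_longestResidueRun :
    (fun p : Nat.Primes => (longestResidueRun p : ℝ)) =O[cofinite]
      fun p => (p : ℝ) ^ (1 / 4 : ℝ) * Real.logb 2 p := by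
  have hlarge : ∀ᶠ n : ℕ in cofinite, 8000 * (Nat.clog 2 n : ℝ) ≤ (n : ℝ) ^ (1 / 4 : ℝ) := by
    rw [Nat.cofinite_eq_atTop]
    refine ((isLittleO_clog_two_rpow (s := 1 / 4) (by norm_num)).def
      (by norm_num : (0 : ℝ) < 1 / 8000)).mono
      fun n hn => ?_
    rw [Real.norm_natCast, Real.norm_of_nonneg (by positivity)] at hn
    linarith
  refine IsBigO.of_bound 1800 ((Subtype.coe_injective.tendsto_cofinite.eventually
    hlarge).mono fun p hp => ?_)
  have := Fact.mk p.2
  rw [Real.norm_natCast]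
  refine le_trans ?_ (mul_le_mul_of_nonneg_left (Real.le_norm_self _) (by norm_num))
  calc (longestResidueRun p : ℝ) ≤ 900 * (Nat.clog 2 p * (p : ℝ) ^ (1 / 4 : ℝ)) :=
        longestResidueRun_le_of_clog_le hp
    _ ≤ 900 * (2 * Real.logb 2 p * (p : ℝ) ^ (1 / 4 : ℝ)) := by
        gcongr
        exact natCast_clog_two_le p.2.two_le
    _ = 1800 * ((p : ℝ) ^ (1 / 4 : ℝ) * Real.logb 2 p) := by ring

end LongestRun

theorem theoremt :
    ∃ C : ℝ, 0 < C ∧ ∀ p : ℕ, p.Prime →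
      (longestResidueRun p : ℝ) ≤ C * (p : ℝ) ^ (1 / 4 : ℝ) * Real.logb 2 (p : ℝ) := by
  obtain ⟨C, hC, hbound⟩ := Asymptotics.bound_of_isBigO_cofinite isBigO_longestResidueRun
  refine ⟨C, hC, fun p hp => ?_⟩
  have hpos : 0 < (p : ℝ) ^ (1 / 4 : ℝ) * Real.logb 2 p :=
    mul_pos (Real.rpow_pos_of_pos (by exact_mod_cast hp.pos) _)
      (Real.logb_pos one_lt_two (by exact_mod_cast hp.one_lt))
  have hp' := @hbound ⟨p, hp⟩ hpos.ne'
  rwa [Real.norm_natCast, Real.norm_of_nonneg hpos.le, ← mul_assoc] at hp'
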